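/- Classical secretary problem: $n\ge 1$ candidates with distinct ranks $1$ (best) to $n$ arrive one after the other, all $n!$ orders of arrival being equally likely. Let $I_k=1$ if the $k$-th candidate is better than all previous ones (relative rank $1$), and $I_k=0$ otherwise. Let $\mathcal F_k$ be the $\sigma$-field generated by $I_1,\dots,I_k$ or, alternatively, the one generated by the relative ranks of the first $k$ candidates, where the relative rank of the $j$-th candidate is its rank among the first $j$; the statement holds for either choice. A stopping rule is a stopping time $\tau$ of $(\mathcal F_k)_{1\le k\le n}$ with values in $\{1,\dots,n\}$; it wins if the candidate at position $\tau$ is the best of all $n$, that is, if $\tau$ is the last $k\le n$ with $I_k=1$. Let $V(n)$ be the supremum of the probability of winning over all stopping rules. An index $s\in\{1,\dots,n\}$ is an optimal threshold for $n$ candidates if the rule that stops at the first $k$ with $s\le k\le n$ and $I_k=1$, and at $n$ if there is no such $k$, is a stopping rule whose probability of winning is maximal among all stopping rules. **Theorem 5.1.** (i) The optimal win probability $V(n)$ is strictly decreasing in $n$ for $n\ge 3$, that is, $V(m)>V(n)$ whenever $3\le m<n$. (ii) For every $n\ge 3$ there is exactly one optimal threshold $s(n)\in\{1,\dots,n\}$.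 -/

import Mathlib

open MeasureTheory

namespace Secretary

/-- The sample space for `n` candidates: `ω k` is the absolute rank of the candidate arriving at
position `k`, the smallest rank being the best. Ranks and positions are counted from `0`. -/
abbrev Arrangement (n : ℕ) : Type := Equiv.Perm (Fin n)

/-- Every set of arrangements is an event. -/
instance instMeasurableSpaceArrangement (n : ℕ) : MeasurableSpace (Arrangement n) := ⊤

/-- All `n!` orders of arrival are equally likely. -/
noncomputable def law (n : ℕ) : Measure (Arrangement n) :=
  ProbabilityTheory.uniformOn Set.univ

/-- The `k`-th candidate is better than all previous ones, i.e. has relative rank 1. -/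
def IsRecord {n : ℕ} (ω : Arrangement n) (k : Fin n) : Prop := ∀ j, j < k → ω k < ω j

instance instDecidableIsRecord {n : ℕ} (ω : Arrangement n) (k : Fin n) :
    Decidable (IsRecord ω k) :=
  inferInstanceAs (Decidable (∀ j, j < k → ω k < ω j))

/-- The indicator `I_k` of the event that the `k`-th candidate has relative rank 1. -/
def indicator {n : ℕ} (k : Fin n) (ω : Arrangement n) : ℕ := if IsRecord ω k then 1 else 0

/-- The relative rank of the `k`-th candidate among the first ones up to and including itself
(the best has relative rank `1`). -/
def relativeRank {n : ℕ} (k : Fin n) (ω : Arrangement n) : ℕ :=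
  (Finset.univ.filter fun j : Fin n => j ≤ k ∧ ω j ≤ ω k).card

/-- The filtration generated by a sequence of discrete observations. -/
def generatedFiltration {n : ℕ} (X : Fin n → Arrangement n → ℕ) :
    Filtration (Fin n) (instMeasurableSpaceArrangement n) where
  seq k := ⨆ j : Fin n, ⨆ _ : j ≤ k, MeasurableSpace.comap (X j) ⊤
  mono' _ _ h := iSup_mono fun _ => iSup_mono' fun hj => ⟨hj.trans h, le_rfl⟩
  le' _ := le_top

/-- At each time the decision maker knows which of the candidates so far were records. -/
def recordFiltration (n : ℕ) : Filtration (Fin n) (instMeasurableSpaceArrangement n) :=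
  generatedFiltration indicator

/-- At each time the decision maker knows the relative ranks of the candidates so far. -/
def rankFiltration (n : ℕ) : Filtration (Fin n) (instMeasurableSpaceArrangement n) :=
  generatedFiltration relativeRank

/-- `τ` is a non-anticipative rule that stops at one of the `n` positions. -/
def IsStoppingRule {n : ℕ} (𝓕 : Filtration (Fin n) (instMeasurableSpaceArrangement n))
    (τ : Arrangement n → Fin n) : Prop :=
  IsStoppingTime 𝓕 fun ω => (τ ω : WithTop (Fin n))

/-- The probability that `τ` stops on the best of all `n` candidates. -/
noncomputable def winProb {n : ℕ} (τ : Arrangement n → Fin n) : ℝ :=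
  (law n).real {ω | ∀ j, ω (τ ω) ≤ ω j}

/-- The optimal win probability `V(n)`. -/
noncomputable def optimalWinProb {n : ℕ}
    (𝓕 : Filtration (Fin n) (instMeasurableSpaceArrangement n)) : ℝ :=
  sSup (winProb '' {τ | IsStoppingRule 𝓕 τ})

/-- `τ` maximizes the win probability among all stopping rules. -/
def IsOptimal {n : ℕ} (𝓕 : Filtration (Fin n) (instMeasurableSpaceArrangement n))
    (τ : Arrangement n → Fin n) : Prop :=
  IsStoppingRule 𝓕 τ ∧ ∀ τ', IsStoppingRule 𝓕 τ' → winProb τ' ≤ winProb τ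

/-- The threshold rule: stop at the first record from position `s` on, and at the last position if
there is none. -/
def thresholdRule {n : ℕ} (s : Fin n) (ω : Arrangement n) : Fin n :=
  if h : (Finset.univ.filter fun k : Fin n => s ≤ k ∧ IsRecord ω k).Nonempty then
    (Finset.univ.filter fun k : Fin n => s ≤ k ∧ IsRecord ω k).min' h
  else ⟨n - 1, Nat.sub_one_lt_of_lt s.isLt⟩

/-- `s` is an optimal threshold: the rule with threshold `s` solves the problem. -/
def IsOptimalThreshold {n : ℕ} (𝓕 : Filtration (Fin n) (instMeasurableSpaceArrangement n))
    (s : Fin n) : Prop :=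
  IsOptimal 𝓕 (thresholdRule s)

end Secretary

/-! Write R(n,k) for the sum of 1/j over k < j < n. Rejecting the first k candidates and then taking
the next record wins with probability P(n,k) = (1 + k R(n,k))/n, and P(n,k+1) - P(n,k) = (R(n,k) -
1)/n for k + 1 < n. As R decreases in k, P(n,·) rises and then falls, with a tie only where R = 1;
for n ≥ 3 a 2-adic argument excludes this (`reciprocalSum_ne_one`), so the maximizer r is unique.

That no rule beats P(n,r) is a weighted summation over stopping times (`sum_le_mul_thresholdValue`).
It rests on the independence of "best at m" from the order of the others (`law_real_inter_best`).
Threshold rules are adapted to the record filtration, and the bound holds for the rank filtration,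
so both filtrations give the same answer.

For monotonicity, delete the worst of n + 1 candidates: it is among the first k + 1 with probability
(k+1)/(n+1). So, for k + 1 < n, P(n+1,k+1) is the mean of P(n,k) and P(n,k+1) with weights
(k+1)/(n+1) and (n-k)/(n+1). These values differ because R(n,k) ≠ 1, so one of them exceeds the mean
(`exists_thresholdValue_lt`). -/

namespace Secretary

/-! ### Sums of consecutive reciprocals -/

/-- The sum of the reciprocals of the integers strictly between `k` and `n`. -/
noncomputable def reciprocalSum (n k : ℕ) : ℝ := ∑ j ∈ Finset.Ico (k + 1) n, (1 / j : ℝ)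

lemma reciprocalSum_eq_add {n k : ℕ} (h : k + 1 < n) :
    reciprocalSum n k = 1 / (k + 1) + reciprocalSum n (k + 1) := by
  rw [reciprocalSum, reciprocalSum, Finset.sum_eq_sum_Ico_succ_bot h]
  push_cast
  rfl

lemma reciprocalSum_succ {n k : ℕ} (h : k < n) :
    reciprocalSum (n + 1) k = reciprocalSum n k + 1 / n := by
  rw [reciprocalSum, reciprocalSum, Finset.sum_Ico_succ_top (by lia)]

lemma reciprocalSum_of_le {n k : ℕ} (h : n ≤ k + 1) : reciprocalSum n k = 0 := by
  rw [reciprocalSum, Finset.Ico_eq_empty_of_le h, Finset.sum_empty]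

lemma reciprocalSum_anti (n : ℕ) : Antitone (reciprocalSum n) := fun a b h =>
  Finset.sum_le_sum_of_subset_of_nonneg (Finset.Ico_subset_Ico_left (by lia))
    fun _ _ _ => by positivity

lemma reciprocalSum_eq_harmonic_sub {n k : ℕ} (h : k < n) :
    reciprocalSum n k = ((harmonic (n - 1) - harmonic k : ℚ) : ℝ) := by
  obtain ⟨d, rfl⟩ : ∃ d, n = k + 1 + d := ⟨n - (k + 1), by lia⟩
  induction d with
  | zero => simp [reciprocalSum]
  | succ d ih =>
    rw [← add_assoc, reciprocalSum_succ (by lia), ih (by lia)]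
    have : k + 1 + d + 1 - 1 = (k + 1 + d - 1) + 1 := by lia
    rw [this, harmonic_succ, Nat.sub_add_cancel (by lia)]
    push_cast
    ring

/-- If k and n - 1 lie in the same dyadic block then n - 1 < 2k, so there are fewer than k terms,
each at most 1/(k+1). -/
lemma reciprocalSum_lt_one_of_log_eq {n k : ℕ} (hn : 3 ≤ n) (hk : k < n)
    (h : Nat.log 2 k = Nat.log 2 (n - 1)) : reciprocalSum n k < 1 := by
  have hk0 : k ≠ 0 := by
    rintro rfl
    have : 0 < Nat.log 2 (n - 1) := Nat.log_pos (by norm_num) (by lia)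
    rw [Nat.log_zero_right] at h
    lia
  have h1 : 2 ^ Nat.log 2 k ≤ k := Nat.pow_log_le_self 2 hk0
  have h2 : n - 1 < 2 ^ (Nat.log 2 (n - 1) + 1) := Nat.lt_pow_succ_log_self (by norm_num) _
  rw [← h, pow_succ] at h2
  calc reciprocalSum n k ≤ ∑ j ∈ Finset.Ico (k + 1) n, (1 / (k + 1) : ℝ) := by
        refine Finset.sum_le_sum fun j hj => ?_
        have : ((k + 1 : ℕ) : ℝ) ≤ j := by exact_mod_cast (Finset.mem_Ico.1 hj).1
        push_cast at this
        exact one_div_le_one_div_of_le (by positivity) this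
    _ = ((n - (k + 1) : ℕ) : ℝ) / (k + 1) := by simp [div_eq_mul_inv]
    _ < 1 := by
        rw [div_lt_one (by positivity)]
        exact_mod_cast (by lia : n - (k + 1) < k + 1)

/-- A sum of reciprocals of consecutive integers is never equal to `1`, the single term `1`
excepted. -/
lemma reciprocalSum_ne_one {n k : ℕ} (hn : 3 ≤ n) (hk : k < n) : reciprocalSum n k ≠ 1 := by
  intro h
  have hlog : Nat.log 2 k ≠ Nat.log 2 (n - 1) := fun h' =>
    (reciprocalSum_lt_one_of_log_eq hn hk h').ne h
  have hpos : 0 < Nat.log 2 (n - 1) := Nat.log_pos (by norm_num) (by lia)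
  rw [reciprocalSum_eq_harmonic_sub hk] at h
  have h' : harmonic (n - 1) = harmonic k + 1 := by
    have : harmonic (n - 1) - harmonic k = 1 := by exact_mod_cast h
    linarith
  -- The harmonic number of m has 2-adic valuation -log₂ m. Adding 1 keeps it when log₂ k > 0,
  -- forcing equal logarithms; k = 0 and k = 1 give the sums 1 and 2, of nonnegative valuation.
  have hv := congrArg (padicValRat 2) h'
  rw [padicValRat_two_harmonic] at hv
  rcases Nat.eq_zero_or_pos k with rfl | hk0
  · simp at hv
    lia
  have hk' := harmonic_pos hk0.ne'
  rcases Nat.eq_zero_or_pos (Nat.log 2 k) with h0 | h0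
  · have hk1 : k = 1 := by
      have := Nat.log_eq_zero_iff.1 h0
      lia
    subst hk1
    have h2 : harmonic 1 + 1 = (2 : ℕ) := by norm_num [harmonic]
    rw [h2, padicValRat.of_nat] at hv
    lia
  · rw [padicValRat.add_eq_min (by positivity) hk'.ne' one_ne_zero
      (by rw [padicValRat_two_harmonic, padicValRat.one]; lia), padicValRat_two_harmonic,
      padicValRat.one] at hv
    lia

/-! ### Unimodality of the threshold values and comparison of n with n + 1 -/

/-- The win probability of the rule that rejects the first `k` of `n` candidates. -/
noncomputable def thresholdValue (n k : ℕ) : ℝ := (1 + k * reciprocalSum n k) / n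

lemma thresholdValue_sub {n k : ℕ} (h : k + 1 < n) :
    thresholdValue n (k + 1) - thresholdValue n k = (reciprocalSum n k - 1) / n := by
  rw [thresholdValue, thresholdValue, reciprocalSum_eq_add h]
  push_cast
  field_simp
  ring

lemma thresholdValue_lt_of_le {n k l r : ℕ} (hr : r < n) (h : ∀ j < r, 1 < reciprocalSum n j)
    (hk : k < l) (hl : l ≤ r) : thresholdValue n k < thresholdValue n l := by
  induction l, (hk : k + 1 ≤ l) using Nat.le_induction with
  | base =>
    have := thresholdValue_sub (n := n) (k := k) (by lia)
    have : 0 < (reciprocalSum n k - 1) / n :=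
      div_pos (by linarith [h k (by lia)]) (by exact_mod_cast (by lia : 0 < n))
    linarith
  | succ l hkl ih =>
    have := ih (by lia)
    have := thresholdValue_sub (n := n) (k := l) (by lia)
    have : 0 < (reciprocalSum n l - 1) / n :=
      div_pos (by linarith [h l (by lia)]) (by exact_mod_cast (by lia : 0 < n))
    linarith

lemma thresholdValue_lt_of_ge {n k r : ℕ} (hn : 3 ≤ n) (h : reciprocalSum n r ≤ 1)
    (hk : r < k) (hl : k < n) : thresholdValue n k < thresholdValue n r := by
  have key : ∀ j, r ≤ j → j + 1 < n → thresholdValue n (j + 1) < thresholdValue n j := by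
    intro j hj hjn
    have h1 := thresholdValue_sub hjn
    have h2 : reciprocalSum n j < 1 :=
      ((reciprocalSum_anti n hj).trans h).lt_of_ne (reciprocalSum_ne_one hn (by lia))
    have h3 : (reciprocalSum n j - 1) / n < 0 :=
      div_neg_of_neg_of_pos (by linarith) (by exact_mod_cast (by lia : 0 < n))
    linarith
  induction k, (hk : r + 1 ≤ k) using Nat.le_induction with
  | base => exact key r le_rfl hl
  | succ k hrk ih => exact (key k (by lia) hl).trans (ih (by lia))

/-- The number of candidates rejected by the optimal threshold rule. -/
lemma exists_threshold {n : ℕ} (hn : 0 < n) :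
    ∃ r < n, reciprocalSum n r ≤ 1 ∧ ∀ j < r, 1 < reciprocalSum n j := by
  classical
  have hex : ∃ r, reciprocalSum n r ≤ 1 :=
    ⟨n - 1, by rw [reciprocalSum_of_le (by lia)]; exact zero_le_one⟩
  refine ⟨Nat.find hex, ?_, Nat.find_spec hex, fun j hj => not_le.1 (Nat.find_min hex hj)⟩
  have : Nat.find hex ≤ n - 1 :=
    Nat.find_min' hex (by rw [reciprocalSum_of_le (by lia)]; exact zero_le_one)
  lia

/-- With one candidate less, some threshold rule does strictly better. -/
lemma exists_thresholdValue_lt {n r : ℕ} (hn : 3 ≤ n) (hr : r < n + 1) :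
    ∃ k < n, thresholdValue (n + 1) r < thresholdValue n k := by
  have hn0 : (0 : ℝ) < n := by exact_mod_cast (by lia : 0 < n)
  rcases r with _ | k
  · refine ⟨0, by lia, ?_⟩
    simp only [thresholdValue]
    push_cast
    rw [zero_mul, zero_mul, add_zero]
    exact one_div_lt_one_div_of_lt hn0 (by linarith)
  have hkn : (k : ℝ) + 1 ≤ n := by exact_mod_cast (by lia : k + 1 ≤ n)
  -- Everything is expressed through R(n,k), whose position relative to 1 decides between k and k +
  -- 1.
  have hv : thresholdValue (n + 1) (k + 1) = (k + 1) * (reciprocalSum n k + 1 / n) / (n + 1) := by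
    have h1 : thresholdValue (n + 1) (k + 1)
        = (k + 1) * (1 / (k + 1) + reciprocalSum (n + 1) (k + 1)) / (n + 1) := by
      rw [thresholdValue]
      push_cast
      field_simp
    rw [h1, ← reciprocalSum_succ (by lia)]
    by_cases h : k + 1 < n + 1
    · rw [← reciprocalSum_eq_add h]
    · lia
  rw [hv]
  rcases lt_or_gt_of_ne (reciprocalSum_ne_one hn (by lia : k < n)) with h | h
  · refine ⟨k, by lia, ?_⟩
    rw [thresholdValue, div_lt_div_iff₀ (by linarith) hn0]
    have : (k + 1 : ℝ) * (reciprocalSum n k + 1 / n) * n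
        = (k + 1) * (n * reciprocalSum n k + 1) := by field_simp
    rw [this]
    -- The cross products differ by exactly (n - k)(1 - R).
    nlinarith [mul_pos (by linarith : (0 : ℝ) < n - k) (sub_pos.2 h)]
  · have hk1 : k + 1 < n := by
      by_contra hc
      rw [reciprocalSum_of_le (by lia)] at h
      linarith
    refine ⟨k + 1, hk1, ?_⟩
    have h1 : thresholdValue n (k + 1) = (k + 1) * reciprocalSum n k / n := by
      rw [thresholdValue, reciprocalSum_eq_add hk1]
      push_cast
      field_simp
    rw [h1, div_lt_div_iff₀ (by linarith) hn0]
    have : (k + 1 : ℝ) * (reciprocalSum n k + 1 / n) * n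
        = (k + 1) * (n * reciprocalSum n k + 1) := by field_simp
    rw [this]
    -- Here the difference is (k + 1)(R - 1).
    nlinarith [mul_pos (by positivity : (0 : ℝ) < k + 1) (sub_pos.2 h)]

/-! ### The uniform law and relative order -/

variable {n : ℕ}

lemma measurableSet_arrangement (A : Set (Arrangement n)) : MeasurableSet A := trivial

instance instIsProbabilityMeasureLaw : IsProbabilityMeasure (law n) :=
  haveI : MeasurableSingletonClass (Arrangement n) := ⟨fun _ => trivial⟩
  ProbabilityTheory.instIsProbabilityMeasure_uniformOn_univ

/-- The probability of an event is preserved by a bijection of arrangements. -/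
lemma law_real_preimage (e : Arrangement n ≃ Arrangement n) (A : Set (Arrangement n)) :
    (law n).real (e ⁻¹' A) = (law n).real A := by
  have : MeasurableSingletonClass (Arrangement n) := ⟨fun _ => trivial⟩
  rw [measureReal_def, measureReal_def, law, ProbabilityTheory.uniformOn_univ,
    ProbabilityTheory.uniformOn_univ, Measure.count_apply (measurableSet_arrangement _),
    Measure.count_apply (measurableSet_arrangement _), Set.encard_preimage_of_bijective e.bijective]

/-- The candidate at position `k` is the best of all. -/
def best (k : Fin n) : Set (Arrangement n) := {ω | ∀ j, ω k ≤ ω j}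

/-- The candidate at position `k` is the best so far. -/
def record (k : Fin n) : Set (Arrangement n) := {ω | IsRecord ω k}

/-- Membership in `A` depends only on the relative order of the candidates at positions in `S`. -/
def DependsOnOrder (S : Set (Fin n)) (A : Set (Arrangement n)) : Prop :=
  ∀ ω ω' : Arrangement n, (∀ i ∈ S, ∀ j ∈ S, (ω i ≤ ω j ↔ ω' i ≤ ω' j)) → ω ∈ A → ω' ∈ A

lemma DependsOnOrder.mono {S T : Set (Fin n)} {A : Set (Arrangement n)} (h : DependsOnOrder S A)
    (hST : S ⊆ T) : DependsOnOrder T A :=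
  fun ω ω' hω => h ω ω' fun i hi j hj => hω i (hST hi) j (hST hj)

lemma DependsOnOrder.inter {S : Set (Fin n)} {A B : Set (Arrangement n)} (hA : DependsOnOrder S A)
    (hB : DependsOnOrder S B) : DependsOnOrder S (A ∩ B) :=
  fun ω ω' hω h => ⟨hA ω ω' hω h.1, hB ω ω' hω h.2⟩

lemma dependsOnOrder_record (k : Fin n) : DependsOnOrder (Set.Iic k) (record k) := by
  intro ω ω' h hω j hj
  have h1 := h j (Set.mem_Iic.2 hj.le) k (Set.mem_Iic.2 le_rfl)
  exact not_le.1 fun h2 => (hω j hj).not_ge (h1.2 h2)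

lemma best_subset_record (k : Fin n) : best k ⊆ record k := fun ω hω j hj =>
  (hω j).lt_of_ne fun h => hj.ne' (ω.injective h)

lemma eq_of_mem_best {ω : Arrangement n} {k l : Fin n} (hk : ω ∈ best k) (hl : ω ∈ best l) :
    k = l :=
  ω.injective ((hk l).antisymm (hl k))

lemma exists_mem_best (k : Fin n) (ω : Arrangement n) : ∃ m, ω ∈ best m := by
  have : Nonempty (Fin n) := ⟨k⟩
  exact Finite.exists_min ω

lemma mem_best_iff {N : ℕ} {ω : Arrangement (N + 1)} {k : Fin (N + 1)} :
    ω ∈ best k ↔ ω k = 0 := by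
  constructor
  · intro h
    have := h (ω.symm 0)
    rwa [Equiv.apply_symm_apply, Fin.le_zero_iff] at this
  · intro h j
    rw [h]
    exact Fin.zero_le _

lemma cycleRange_le_cycleRange_iff {N : ℕ} {c x y : Fin (N + 1)} (hx : x ≠ c) (hy : y ≠ c) :
    c.cycleRange x ≤ c.cycleRange y ↔ x ≤ y := by
  obtain ⟨x, rfl⟩ := Fin.exists_succAbove_eq hx
  obtain ⟨y, rfl⟩ := Fin.exists_succAbove_eq hy
  rw [Fin.cycleRange_succAbove, Fin.cycleRange_succAbove, Fin.succ_le_succ_iff,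
    Fin.succAbove_le_succAbove_iff]

lemma sum_law_real_inter (f : Arrangement n → Fin n) (A : Set (Arrangement n)) :
    ∑ c, (law n).real (A ∩ {ω | f ω = c}) = (law n).real A := by
  rw [← measureReal_biUnion_finset _ fun _ _ => measurableSet_arrangement _]
  · congr 1
    ext ω
    simp
  · intro c _ d _ hcd
    exact Set.disjoint_left.2 fun ω h1 h2 => hcd (h1.2.symm.trans h2.2)

/-- Being the best of all at position `m` is independent of the relative order of the others. -/
lemma law_real_inter_best {m : Fin n} {A : Set (Arrangement n)} (hA : DependsOnOrder {m}ᶜ A) :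
    (law n).real (A ∩ best m) = (law n).real A / n := by
  obtain _ | N := n
  · exact m.elim0
  have key : ∀ c, (law (N + 1)).real (A ∩ {ω | ω m = c}) = (law (N + 1)).real (A ∩ best m) := by
    intro c
    -- Cycling rank c to the top keeps the order of all other ranks, so every rank at m is equally
    -- likely given `A`.
    rw [← law_real_preimage (Equiv.mulLeft c.cycleRange) (A ∩ best m)]
    congr 1
    ext ω
    have h0 : c.cycleRange (ω m) = 0 ↔ ω m = c := by
      rw [← Fin.cycleRange_self c, EmbeddingLike.apply_eq_iff_eq]
    simp only [Set.mem_inter_iff, Set.mem_ofPred_eq, Set.mem_preimage, mem_best_iff,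
      Equiv.coe_mulLeft, Equiv.Perm.mul_apply, h0]
    refine and_congr_left fun hm => ?_
    have hne : ∀ i ∈ ({m}ᶜ : Set (Fin (N + 1))), ω i ≠ c := fun i hi h =>
      hi (ω.injective (h.trans hm.symm))
    constructor
    · refine hA _ _ fun i hi j hj => ?_
      exact (cycleRange_le_cycleRange_iff (hne i hi) (hne j hj)).symm
    · refine hA _ _ fun i hi j hj => ?_
      exact cycleRange_le_cycleRange_iff (hne i hi) (hne j hj)
  have hsum := sum_law_real_inter (fun ω => ω m) A
  simp only [key, Finset.sum_const, Finset.card_univ, Fintype.card_fin, nsmul_eq_mul] at hsum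
  rw [← hsum]
  field_simp

lemma sum_law_real_inter_best (k : Fin n) (A : Set (Arrangement n)) :
    ∑ m, (law n).real (A ∩ best m) = (law n).real A := by
  choose f hf using exists_mem_best k
  rw [← sum_law_real_inter f A]
  refine Finset.sum_congr rfl fun m _ => ?_
  congr 2
  ext ω
  exact ⟨fun h => eq_of_mem_best (hf ω) h, fun h => h ▸ hf ω⟩

/-- Given the relative order up to a record at position `k`, that record is the best of all with
probability `(k + 1) / n`, positions being counted from `0`. -/
lemma mul_law_real_inter_best {k : Fin n} {A : Set (Arrangement n)}
    (hA : DependsOnOrder (Set.Iic k) A) (hk : A ⊆ record k) :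
    n * (law n).real (A ∩ best k) = (k + 1) * (law n).real A := by
  have hn : (0 : ℝ) < n := by exact_mod_cast k.pos
  -- Split by the position m of the best: m < k contradicts the record at k, each m > k contributes
  -- P(A)/n, and m = k gets what remains.
  have hm : ∀ m, (law n).real (A ∩ best m) = (if m = k then (law n).real (A ∩ best k) else 0)
      + if k < m then (law n).real A / n else 0 := by
    intro m
    rcases lt_trichotomy m k with h | rfl | h
    · have : A ∩ best m = ∅ := by
        refine Set.eq_empty_of_forall_notMem fun ω hω => ?_
        exact (hk hω.1 m h).not_ge (hω.2 k)
      rw [this, measureReal_empty, if_neg h.ne, if_neg h.not_gt, add_zero]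
    · simp
    · rw [if_neg h.ne', if_pos h, zero_add, law_real_inter_best]
      exact hA.mono fun i hi => ((Set.mem_Iic.1 hi).trans_lt h).ne
  have hsum := sum_law_real_inter_best k A
  rw [Finset.sum_congr rfl fun m _ => hm m, Finset.sum_add_distrib, Finset.sum_ite_eq',
    if_pos (Finset.mem_univ _), ← Finset.sum_filter, Finset.filter_lt_eq_Ioi, Finset.sum_const, Fin.card_Ioi,
    nsmul_eq_mul, Nat.sub_sub, Nat.cast_sub (by lia : 1 + (k : ℕ) ≤ n)] at hsum
  push_cast at hsum
  field_simp at hsum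
  linarith

/-- The candidate at position `k` is a record with probability `1 / (k + 1)`, independently of the
relative order of the previous ones. -/
lemma law_real_inter_record {k : Fin n} {A : Set (Arrangement n)}
    (hA : DependsOnOrder (Set.Iio k) A) :
    (law n).real (A ∩ record k) = (law n).real A / (k + 1) := by
  have hn : (0 : ℝ) < n := by exact_mod_cast k.pos
  -- The event that `A` holds and k is best is evaluated twice, using that the best is a record.
  have h1 := law_real_inter_best (hA.mono (T := {k}ᶜ) fun i hi => ne_of_lt hi)
  have h2 := mul_law_real_inter_best
    ((hA.mono Set.Iio_subset_Iic_self).inter (dependsOnOrder_record k)) Set.inter_subset_right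
  rw [Set.inter_assoc, Set.inter_eq_self_of_subset_right (best_subset_record k), h1] at h2
  rw [eq_div_iff (by positivity), mul_comm, ← h2]
  field_simp

/-! ### Filtrations and stopping rules -/

lemma winProb_eq_sum (τ : Arrangement n → Fin n) :
    winProb τ = ∑ k, (law n).real ({ω | τ ω = k} ∩ best k) := by
  rw [winProb, ← sum_law_real_inter τ]
  refine Finset.sum_congr rfl fun k _ => ?_
  congr 1
  ext ω
  simp only [best, Set.mem_inter_iff, Set.mem_ofPred_eq]
  constructor
  · rintro ⟨h, rfl⟩
    exact ⟨rfl, h⟩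
  · rintro ⟨rfl, h⟩
    exact ⟨h, rfl⟩

lemma relativeRank_congr {ω ω' : Arrangement n} {k : Fin n}
    (h : ∀ i ≤ k, ω i ≤ ω k ↔ ω' i ≤ ω' k) : relativeRank k ω = relativeRank k ω' := by
  rw [relativeRank, relativeRank]
  congr 1
  exact Finset.filter_congr fun i _ => and_congr_right (h i)

lemma dependsOnOrder_of_measurableSet {k : Fin n} {A : Set (Arrangement n)}
    (hA : MeasurableSet[rankFiltration n k] A) : DependsOnOrder (Set.Iic k) A := by
  have hle : (rankFiltration n k : MeasurableSpace (Arrangement n)) ≤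
      MeasurableSpace.comap (fun ω (j : Set.Iic k) => relativeRank j.1 ω) ⊤ := by
    refine iSup₂_le fun j hj => ?_
    rintro _ ⟨B, -, rfl⟩
    exact ⟨{f | f ⟨j, hj⟩ ∈ B}, trivial, rfl⟩
  obtain ⟨B, -, rfl⟩ := hle _ hA
  intro ω ω' h hω
  have : (fun j : Set.Iic k => relativeRank j.1 ω') = fun j : Set.Iic k => relativeRank j.1 ω :=
    funext fun j => (relativeRank_congr fun i hi =>
      h i (hi.trans j.2) j.1 j.2).symm
  rw [Set.mem_preimage, this]
  exact hω

lemma isRecord_iff_relativeRank {ω : Arrangement n} {k : Fin n} :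
    IsRecord ω k ↔ relativeRank k ω = 1 := by
  rw [relativeRank, Finset.card_eq_one]
  constructor
  · intro h
    refine ⟨k, Finset.ext fun j => ?_⟩
    simp only [Finset.mem_filter_univ, Finset.mem_singleton]
    constructor
    · rintro ⟨hj, hω⟩
      exact hj.eq_of_not_lt fun hlt => (h j hlt).not_ge hω
    · rintro rfl
      exact ⟨le_rfl, le_rfl⟩
  · rintro ⟨a, ha⟩ j hj
    have hk : k = a := by
      rw [← Finset.mem_singleton, ← ha, Finset.mem_filter_univ]
      exact ⟨le_rfl, le_rfl⟩
    refine not_le.1 fun hle => hj.ne ?_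
    rw [hk, ← Finset.mem_singleton, ← ha, Finset.mem_filter_univ]
    exact ⟨hj.le, hle⟩

lemma measurableSet_record {j k : Fin n} (h : j ≤ k) :
    MeasurableSet[recordFiltration n k] (record j) := by
  have hle : MeasurableSpace.comap (indicator j) ⊤ ≤
      (recordFiltration n k : MeasurableSpace (Arrangement n)) :=
    le_iSup₂_of_le (f := fun (j : Fin n) (_ : j ≤ k) => MeasurableSpace.comap (indicator j) ⊤)
      j h le_rfl
  refine hle _ ⟨{1}, trivial, ?_⟩
  ext ω
  simp [indicator, record]

lemma recordFiltration_le_rankFiltration (n : ℕ) : recordFiltration n ≤ rankFiltration n := by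
  intro k
  refine iSup₂_le fun j hj => ?_
  refine le_trans ?_ (le_iSup₂_of_le
    (f := fun (j : Fin n) (_ : j ≤ k) => MeasurableSpace.comap (relativeRank j) ⊤) j hj le_rfl)
  have : (indicator j : Arrangement n → ℕ) =
      (fun x => if x = 1 then 1 else 0) ∘ relativeRank j := by
    funext ω
    simp only [indicator, isRecord_iff_relativeRank, Function.comp_apply]
  rw [this, ← MeasurableSpace.comap_comp]
  exact MeasurableSpace.comap_mono le_top

lemma IsStoppingRule.mono {𝓕 𝓖 : Filtration (Fin n) (instMeasurableSpaceArrangement n)}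
    {τ : Arrangement n → Fin n} (hτ : IsStoppingRule 𝓕 τ) (h : 𝓕 ≤ 𝓖) : IsStoppingRule 𝓖 τ :=
  fun k => h k _ (hτ k)

lemma IsStoppingRule.dependsOnOrder_le {τ : Arrangement n → Fin n}
    (hτ : IsStoppingRule (rankFiltration n) τ) (k : Fin n) :
    DependsOnOrder (Set.Iic k) {ω | τ ω ≤ k} := by
  have := dependsOnOrder_of_measurableSet (hτ k)
  simpa only [WithTop.coe_le_coe] using this

/-- If ω' stops before k, the event of stopping by that time is decided by the order before k, so ω
stops early too. This avoids a predecessor of k. -/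
lemma IsStoppingRule.dependsOnOrder_ge {τ : Arrangement n → Fin n}
    (hτ : IsStoppingRule (rankFiltration n) τ) (k : Fin n) :
    DependsOnOrder (Set.Iio k) {ω | k ≤ τ ω} := by
  intro ω ω' h hω
  by_contra hlt
  have hlt : τ ω' < k := not_le.1 hlt
  have hsub : Set.Iic (τ ω') ⊆ Set.Iio k := fun i hi => (Set.mem_Iic.1 hi).trans_lt hlt
  have : τ ω ≤ τ ω' := (hτ.dependsOnOrder_le (τ ω')).mono hsub ω' ω
    (fun i hi j hj => (h i hi j hj).symm) (le_refl (τ ω'))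
  exact (this.trans_lt hlt).not_ge hω

lemma IsStoppingRule.dependsOnOrder_eq {τ : Arrangement n → Fin n}
    (hτ : IsStoppingRule (rankFiltration n) τ) (k : Fin n) :
    DependsOnOrder (Set.Iic k) {ω | τ ω = k} := by
  have := (hτ.dependsOnOrder_le k).inter ((hτ.dependsOnOrder_ge k).mono Set.Iio_subset_Iic_self)
  convert this using 1
  ext ω
  exact le_antisymm_iff

/-! ### Win probability of threshold rules -/

/-- There is no record at the positions `j` with `s ≤ j < k`. -/
def noRecord (s : Fin n) (k : ℕ) : Set (Arrangement n) :=
  {ω | ∀ j : Fin n, s ≤ j → (j : ℕ) < k → ¬ IsRecord ω j}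

lemma dependsOnOrder_noRecord (s k : Fin n) : DependsOnOrder (Set.Iio k) (noRecord s k) := by
  intro ω ω' h hω j hs hj hr
  refine hω j hs hj ?_
  exact (dependsOnOrder_record j).mono (fun i hi => (Set.mem_Iic.1 hi).trans_lt hj) ω' ω
    (fun i hi j hj => (h i hi j hj).symm) hr

lemma law_real_noRecord_self (s : Fin n) : (law n).real (noRecord s s) = 1 := by
  have : noRecord s s = Set.univ :=
    Set.eq_univ_of_forall fun ω j h1 h2 => absurd h2 (not_lt.2 h1)
  rw [this, probReal_univ]

lemma law_real_noRecord_succ {s k : Fin n} (h : s ≤ k) :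
    (law n).real (noRecord s (k + 1)) = (law n).real (noRecord s k) * (k / (k + 1)) := by
  have h1 := law_real_inter_record (dependsOnOrder_noRecord s k)
  have h2 := measureReal_inter_add_sdiff (μ := law n) (s := noRecord s k)
    (measurableSet_arrangement (record k))
  have h3 : noRecord s (k + 1) = noRecord s k \ record k := by
    ext ω
    constructor
    · exact fun hω => ⟨fun j hs hj => hω j hs (hj.trans (Nat.lt_succ_self _)),
        hω k h (Nat.lt_succ_self _)⟩
    · rintro ⟨hω, hr⟩ j hs hj
      rcases (Nat.lt_succ_iff.1 hj).lt_or_eq with hj | hj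
      · exact hω j hs hj
      · rwa [Fin.ext hj]
  rw [h3, ← sub_eq_iff_eq_add'.2 h2.symm, h1]
  field_simp
  ring

lemma law_real_noRecord {s : Fin n} {k : ℕ} (hs : (s : ℕ) < k) (hk : k ≤ n) :
    (law n).real (noRecord s k) = s / k := by
  induction k, (hs : (s : ℕ) + 1 ≤ k) using Nat.le_induction with
  | base =>
    rw [law_real_noRecord_succ le_rfl, law_real_noRecord_self, one_mul]
    push_cast
    rfl
  | succ k hsk ih =>
    have := law_real_noRecord_succ (s := s) (k := ⟨k, hk⟩) (by rw [Fin.le_def]; simp; lia)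
    simp only at this
    have hk0 : (0 : ℝ) < k := by exact_mod_cast (by lia : 0 < k)
    rw [this, ih (by lia)]
    push_cast
    field_simp

lemma isRecord_thresholdRule_or {s : Fin n} (ω : Arrangement n) :
    (s ≤ thresholdRule s ω ∧ IsRecord ω (thresholdRule s ω) ∧
      ∀ j, s ≤ j → IsRecord ω j → thresholdRule s ω ≤ j) ∨
    ((thresholdRule s ω : ℕ) = n - 1 ∧ ∀ j, s ≤ j → ¬ IsRecord ω j) := by
  rw [thresholdRule]
  split_ifs with h
  · left
    have h1 := Finset.min'_mem _ h
    rw [Finset.mem_filter_univ] at h1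
    exact ⟨h1.1, h1.2, fun j hs hj => Finset.min'_le _ _ (by simp [hs, hj])⟩
  · refine Or.inr ⟨rfl, fun j hs hj => h ⟨j, by simp [hs, hj]⟩⟩

lemma le_thresholdRule (s : Fin n) (ω : Arrangement n) : s ≤ thresholdRule s ω := by
  rcases isRecord_thresholdRule_or (s := s) ω with h | h
  · exact h.1
  · rw [Fin.le_def, h.1]
    lia

lemma thresholdRule_le_iff {s k : Fin n} {ω : Arrangement n} :
    thresholdRule s ω ≤ k ↔ (k : ℕ) = n - 1 ∨ ∃ j, s ≤ j ∧ j ≤ k ∧ IsRecord ω j := by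
  rcases isRecord_thresholdRule_or (s := s) ω with h | h
  · constructor
    · exact fun hk => Or.inr ⟨_, h.1, hk, h.2.1⟩
    · rintro (hk | ⟨j, h1, h2, h3⟩)
      · rw [Fin.le_def, hk]
        lia
      · exact (h.2.2 j h1 h3).trans h2
  · rw [Fin.le_def, h.1]
    constructor
    · intro hk
      left
      lia
    · rintro (hk | ⟨j, h1, h2, h3⟩)
      · exact hk.ge
      · exact absurd h3 (h.2 j h1)

lemma isStoppingRule_thresholdRule (s : Fin n) :
    IsStoppingRule (recordFiltration n) (thresholdRule s) := by
  intro k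
  have : {ω : Arrangement n | ((thresholdRule s ω : Fin n) : WithTop (Fin n)) ≤ k} =
      {_ω | (k : ℕ) = n - 1} ∪ ⋃ j : Fin n, ⋃ _ : s ≤ j ∧ j ≤ k, record j := by
    ext ω
    simp [thresholdRule_le_iff, record, and_assoc]
  rw [this]
  exact (MeasurableSet.const _).union <| MeasurableSet.iUnion fun j =>
    MeasurableSet.iUnion fun h => measurableSet_record h.2

/-- The best candidate is a record, so the default stop at the last position plays no role in
winning. -/
lemma thresholdRule_eq_inter_best {s k : Fin n} (h : s ≤ k) :
    {ω | thresholdRule s ω = k} ∩ best k = noRecord s k ∩ best k := by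
  ext ω
  refine and_congr_left fun hb => ?_
  have hr : IsRecord ω k := best_subset_record k hb
  rcases isRecord_thresholdRule_or (s := s) ω with h1 | h1
  · constructor
    · rintro rfl j hs hj hjr
      exact (h1.2.2 j hs hjr).not_gt hj
    · intro hω
      refine (h1.2.2 k h hr).antisymm (not_lt.1 fun hlt => hω _ h1.1 hlt h1.2.1)
  · exact absurd hr (h1.2 k h)

lemma winProb_thresholdRule (s : Fin n) : winProb (thresholdRule s) = thresholdValue n s := by
  have hf : ∀ k : Fin n, (law n).real ({ω | thresholdRule s ω = k} ∩ best k) =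
      -- The case k = s is separate because s / k would be 0 instead of 1 when both vanish.
      if (k : ℕ) < s then 0 else if (k : ℕ) = s then 1 / (n : ℝ) else s * (1 / (k : ℕ)) / n := by
    intro k
    split_ifs with h1 h2
    · have : {ω | thresholdRule s ω = k} ∩ best k = ∅ := by
        refine Set.eq_empty_of_forall_notMem fun ω hω => ?_
        exact (le_thresholdRule s ω).not_gt (by rw [hω.1]; exact h1)
      rw [this, measureReal_empty]
    all_goals
      rw [thresholdRule_eq_inter_best (not_lt.1 h1), law_real_inter_best
        ((dependsOnOrder_noRecord s k).mono fun i hi => ne_of_lt hi)]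
    · rw [h2, law_real_noRecord_self]
    · rw [law_real_noRecord (by lia) k.2.le]
      ring
  rw [winProb_eq_sum, Finset.sum_congr rfl fun k _ => hf k,
    Fin.sum_univ_eq_sum_range (fun k : ℕ => if k < (s : ℕ) then (0 : ℝ) else
      if k = s then 1 / (n : ℝ) else s * (1 / k) / n) n, Finset.range_eq_Ico,
    ← Finset.sum_Ico_consecutive _ (Nat.zero_le s) s.2.le, Finset.sum_eq_sum_Ico_succ_bot s.2,
    Finset.sum_eq_zero, if_neg (lt_irrefl _), if_pos rfl, thresholdValue, reciprocalSum,
    Finset.mul_sum, add_div, Finset.sum_div, zero_add]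
  · congr 1
    refine Finset.sum_congr rfl fun k hk => ?_
    have := (Finset.mem_Ico.1 hk).1
    rw [if_neg (by lia), if_neg (by lia)]
  · intro k hk
    rw [if_pos (Finset.mem_Ico.1 hk).2]

/-! ### Upper bound for arbitrary stopping rules -/

/-- The dynamic programming bound: `t k` stands for the probability of not having stopped before
`k`, and `x k` for the probability of winning at `k`. -/
lemma sum_le_mul_thresholdValue {r : ℕ} {x t : ℕ → ℝ} (hr : r < n)
    (hle : reciprocalSum n r ≤ 1) (hgt : ∀ j < r, 1 < reciprocalSum n j)
    (hx : ∀ k < n, n * x k ≤ t k) (hxt : ∀ k < n, n * x k ≤ (k + 1) * (t k - t (k + 1)))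
    (ht : ∀ k < n, t (k + 1) ≤ t k) :
    ∑ k ∈ Finset.range n, x k ≤ t 0 * thresholdValue n r := by
  have hn : (0 : ℝ) < n := by exact_mod_cast (by lia : 0 < n)
  have late : ∀ d k, k + d + 1 = n → r ≤ k →
      ∑ j ∈ Finset.Ico k n, x j ≤ t k * thresholdValue n k := by
    intro d
    induction d with
    | zero =>
      intro k hk _
      rw [Finset.sum_eq_sum_Ico_succ_bot (by lia), Finset.Ico_eq_empty_of_le (by lia),
        Finset.sum_empty, add_zero, thresholdValue, reciprocalSum_of_le (by lia), mul_zero,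
        add_zero, mul_one_div, le_div_iff₀ hn, mul_comm]
      exact hx k (by lia)
    | succ d ih =>
      intro k hk hrk
      have h1 := ih (k + 1) (by lia) (by lia)
      have h2 : thresholdValue n (k + 1) = (k + 1) * reciprocalSum n k / n := by
        rw [thresholdValue, reciprocalSum_eq_add (by lia : k + 1 < n)]
        push_cast
        field_simp
      have h3 := hx k (by lia)
      have h4 := hxt k (by lia)
      have h5 : reciprocalSum n k ≤ 1 := (reciprocalSum_anti n hrk).trans hle
      have h6 : 0 ≤ reciprocalSum n k := Finset.sum_nonneg fun _ _ => by positivity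
      rw [Finset.sum_eq_sum_Ico_succ_bot (by lia)]
      rw [h2, mul_div_assoc', le_div_iff₀ hn] at h1
      rw [thresholdValue, mul_div_assoc', le_div_iff₀ hn]
      -- The two bounds on n x(k) are averaged with weights 1 - R and R, where R = R(n,k) ∈ [0,1];
      -- the terms in t(k+1) then cancel.
      nlinarith [mul_le_mul_of_nonneg_left h3 (sub_nonneg.2 h5),
        mul_le_mul_of_nonneg_left h4 h6]
  have early : ∀ d k, k + d = r → ∑ j ∈ Finset.Ico k n, x j ≤ t k * thresholdValue n r := by
    intro d
    induction d with
    | zero =>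
      rintro k rfl
      exact late (n - k - 1) k (by lia) le_rfl
    | succ d ih =>
      intro k hk
      have h1 := ih (k + 1) (by lia)
      -- Before r, even stopping on a record wins with chance only (k+1)/n, at most P(n,k+1) because
      -- R(n,k) > 1.
      have h2 : (k + 1 : ℝ) / n ≤ thresholdValue n r := by
        have h3 : thresholdValue n (k + 1) ≤ thresholdValue n r := by
          rcases (by lia : k + 1 ≤ r).lt_or_eq with h | h
          · exact (thresholdValue_lt_of_le hr hgt h le_rfl).le
          · rw [h]
        have h4 : thresholdValue n (k + 1) = (k + 1) * reciprocalSum n k / n := by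
          rw [thresholdValue, reciprocalSum_eq_add (by lia : k + 1 < n)]
          push_cast
          field_simp
        refine le_trans ?_ h3
        rw [h4]
        gcongr
        exact le_mul_of_one_le_right (by positivity) (hgt k (by lia)).le
      have h3 : x k ≤ (k + 1 : ℝ) / n * (t k - t (k + 1)) := by
        rw [div_mul_eq_mul_div, le_div_iff₀ hn, mul_comm]
        exact hxt k (by lia)
      have h4 := mul_le_mul_of_nonneg_right h2 (sub_nonneg.2 (ht k (by lia)))
      rw [Finset.sum_eq_sum_Ico_succ_bot (by lia)]
      linarith
  rw [Finset.range_eq_Ico]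
  exact early r 0 (by lia)

lemma winProb_le {r : ℕ} (hr : r < n) (hle : reciprocalSum n r ≤ 1)
    (hgt : ∀ j < r, 1 < reciprocalSum n j) {τ : Arrangement n → Fin n}
    (hτ : IsStoppingRule (rankFiltration n) τ) : winProb τ ≤ thresholdValue n r := by
  have hn : (0 : ℝ) < n := by exact_mod_cast (by lia : 0 < n)
  let x : ℕ → ℝ := fun k =>
    if h : k < n then (law n).real ({ω | τ ω = ⟨k, h⟩} ∩ best ⟨k, h⟩) else 0
  let t : ℕ → ℝ := fun k => (law n).real {ω | k ≤ (τ ω : ℕ)}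
  have hsum : winProb τ = ∑ k ∈ Finset.range n, x k := by
    rw [winProb_eq_sum, ← Fin.sum_univ_eq_sum_range]
    exact Finset.sum_congr rfl fun k _ => by simp [x]
  have ht0 : t 0 = 1 := by simp [t]
  have ht : ∀ k, t (k + 1) ≤ t k := fun k => measureReal_mono fun ω hω => Nat.le_of_succ_le hω
  rw [hsum, ← one_mul (thresholdValue n r), ← ht0]
  refine sum_le_mul_thresholdValue hr hle hgt (fun k hk => ?_) (fun k hk => ?_) fun k _ => ht k
  · have h1 := law_real_inter_best
      ((hτ.dependsOnOrder_ge ⟨k, hk⟩).mono (T := {⟨k, hk⟩}ᶜ) fun i hi => ne_of_lt hi)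
    have h2 : x k ≤ t k / n := by
      simp only [x, dif_pos hk]
      refine le_trans (measureReal_mono ?_) h1.le
      exact Set.inter_subset_inter_left _ fun ω (hω : τ ω = _) => hω.ge
    rwa [le_div_iff₀ hn, mul_comm] at h2
  · have h1 := mul_law_real_inter_best
      ((hτ.dependsOnOrder_eq ⟨k, hk⟩).inter (dependsOnOrder_record ⟨k, hk⟩)) Set.inter_subset_right
    rw [Set.inter_assoc, Set.inter_eq_self_of_subset_right (best_subset_record _)] at h1
    simp only [x, dif_pos hk]
    rw [h1]
    refine mul_le_mul_of_nonneg_left ?_ (by positivity)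
    have h2 := measureReal_inter_add_sdiff (μ := law n) (s := {ω | k ≤ (τ ω : ℕ)})
      (measurableSet_arrangement {ω | τ ω = ⟨k, hk⟩})
    have h3 : {ω | k ≤ (τ ω : ℕ)} \ {ω | τ ω = ⟨k, hk⟩} = {ω | k + 1 ≤ (τ ω : ℕ)} := by
      ext ω
      simp only [Set.mem_sdiff, Set.mem_ofPred_eq, Fin.ext_iff]
      lia
    have h4 : {ω | τ ω = ⟨k, hk⟩} ∩ record ⟨k, hk⟩ ⊆
        {ω | k ≤ (τ ω : ℕ)} ∩ {ω | τ ω = ⟨k, hk⟩} := by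
      rintro ω ⟨hω, -⟩
      refine ⟨?_, hω⟩
      have hω : τ ω = ⟨k, hk⟩ := hω
      simp [hω]
    rw [h3] at h2
    have := measureReal_mono (μ := law n) h4
    simp only [t]
    linarith

/-! ### Optimal value and optimal threshold -/

lemma optimalWinProb_eq {𝓕 : Filtration (Fin n) (instMeasurableSpaceArrangement n)}
    (h₁ : recordFiltration n ≤ 𝓕) (h₂ : 𝓕 ≤ rankFiltration n) {r : ℕ} (hr : r < n)
    (hle : reciprocalSum n r ≤ 1) (hgt : ∀ j < r, 1 < reciprocalSum n j) :
    optimalWinProb 𝓕 = thresholdValue n r := by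
  refine IsGreatest.csSup_eq ⟨⟨thresholdRule ⟨r, hr⟩, ?_, winProb_thresholdRule _⟩, ?_⟩
  · exact (isStoppingRule_thresholdRule _).mono h₁
  · rintro _ ⟨τ, hτ, rfl⟩
    exact winProb_le hr hle hgt (IsStoppingRule.mono hτ h₂)

lemma thresholdValue_le_optimalWinProb {𝓕 : Filtration (Fin n) (instMeasurableSpaceArrangement n)}
    (h₁ : recordFiltration n ≤ 𝓕) {k : ℕ} (hk : k < n) :
    thresholdValue n k ≤ optimalWinProb 𝓕 := by
  refine le_csSup ⟨1, ?_⟩ ⟨thresholdRule ⟨k, hk⟩, ?_, winProb_thresholdRule _⟩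
  · rintro _ ⟨τ, -, rfl⟩
    exact measureReal_le_one
  · exact (isStoppingRule_thresholdRule _).mono h₁

lemma optimalWinProb_succ_lt {𝓕 : Filtration (Fin n) (instMeasurableSpaceArrangement n)}
    {𝓖 : Filtration (Fin (n + 1)) (instMeasurableSpaceArrangement (n + 1))} (hn : 3 ≤ n)
    (h𝓕 : recordFiltration n ≤ 𝓕) (h𝓖₁ : recordFiltration (n + 1) ≤ 𝓖)
    (h𝓖₂ : 𝓖 ≤ rankFiltration (n + 1)) : optimalWinProb 𝓖 < optimalWinProb 𝓕 := by
  obtain ⟨r, hr, hle, hgt⟩ := exists_threshold (Nat.succ_pos n)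
  obtain ⟨k, hk, hlt⟩ := exists_thresholdValue_lt hn hr
  rw [optimalWinProb_eq h𝓖₁ h𝓖₂ hr hle hgt]
  exact hlt.trans_le (thresholdValue_le_optimalWinProb h𝓕 hk)

lemma existsUnique_isOptimalThreshold
    {𝓕 : Filtration (Fin n) (instMeasurableSpaceArrangement n)} (hn : 3 ≤ n)
    (h₁ : recordFiltration n ≤ 𝓕) (h₂ : 𝓕 ≤ rankFiltration n) :
    ∃! s : Fin n, IsOptimalThreshold 𝓕 s := by
  obtain ⟨r, hr, hle, hgt⟩ := exists_threshold (by lia : 0 < n)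
  have hrule : ∀ s, IsStoppingRule 𝓕 (thresholdRule s) := fun s =>
    (isStoppingRule_thresholdRule s).mono h₁
  refine ⟨⟨r, hr⟩, ⟨hrule _, fun τ hτ => ?_⟩, fun s hs => ?_⟩
  · rw [winProb_thresholdRule]
    exact winProb_le hr hle hgt (hτ.mono h₂)
  · have h := hs.2 _ (hrule ⟨r, hr⟩)
    rw [winProb_thresholdRule, winProb_thresholdRule] at h
    refine Fin.ext (le_antisymm (not_lt.1 fun hlt => ?_) (not_lt.1 fun hlt => ?_))
    · exact (thresholdValue_lt_of_ge hn hle hlt s.2).not_ge h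
    · exact (thresholdValue_lt_of_le hr hgt hlt le_rfl).not_ge h

end Secretary

theorem theorem5p1
    (𝓕 : ∀ n : ℕ, MeasureTheory.Filtration (Fin n) (Secretary.instMeasurableSpaceArrangement n))
    (h𝓕 : 𝓕 = Secretary.recordFiltration ∨ 𝓕 = Secretary.rankFiltration) :
    StrictAntiOn (fun n : ℕ => Secretary.optimalWinProb (𝓕 n)) (Set.Ici 3) ∧
      ∀ n : ℕ, 3 ≤ n → ∃! s : Fin n, Secretary.IsOptimalThreshold (𝓕 n) s := by
  have h₁ : ∀ n, Secretary.recordFiltration n ≤ 𝓕 n := by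
    rcases h𝓕 with rfl | rfl
    · exact fun n => le_rfl
    · exact Secretary.recordFiltration_le_rankFiltration
  have h₂ : ∀ n, 𝓕 n ≤ Secretary.rankFiltration n := by
    rcases h𝓕 with rfl | rfl
    · exact Secretary.recordFiltration_le_rankFiltration
    · exact fun n => le_rfl
  refine ⟨fun m hm n _ hmn => ?_, fun n hn =>
    Secretary.existsUnique_isOptimalThreshold hn (h₁ n) (h₂ n)⟩
  have hm : 3 ≤ m := hm
  induction n, (hmn : m + 1 ≤ n) using Nat.le_induction with
  | base => exact Secretary.optimalWinProb_succ_lt hm (h₁ m) (h₁ _) (h₂ _)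
  | succ n hmn ih =>
    exact (Secretary.optimalWinProb_succ_lt (by lia) (h₁ n) (h₁ _) (h₂ _)).trans
      (ih (Set.mem_Ici.2 (by lia)))
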